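/- Let $\Omega$ be a nonempty set of states, $\mathbb K$ a set of maps $z:[0,\infty)\to\Omega$ (processes) such that every $\omega\in\Omega$ is the initial state $z(0)=\omega$ of some $z\in\mathbb K$, and $g:\Omega\to[0,1]$ a function such that $t\mapsto g(z(t))$ is Lebesgue measurable for every $z\in\mathbb K$. A density is a Lebesgue measurable function $\varrho:[0,\infty)\to[0,\infty)$ with $\int_0^\infty\varrho(t)\,dt=1$; let $\mathfrak D$ be the set of densities. For $\varrho\in\mathfrak D$ and $\omega\in\Omega$ put $$\mathcal V[\varrho](\omega)=\sup_{z\in\mathbb K,\;z(0)=\omega}\int_0^\infty\varrho(t)\,g(z(t))\,dt .$$ For $\lambda>0$ put $\varrho^{\lambda}_{\rm scale}(t)=\lambda\varrho(\lambda t)$, and for $T>0$ with $\int_T^\infty\varrho(s)\,ds>0$ put $\varrho^{T}_{\rm shift}(t)=\varrho(t+T)\big/\int_T^\infty\varrho(s)\,ds$ $(t\ge 0)$. Let $\varpi_T=\frac1T 1_{[0,T]}$ and $\pi_\lambda(t)=\lambda e^{-\lambda t}$. A density is called a power density if it has the form $\varrho(t)=(\alpha+\beta t)^{-\gamma}$,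 $t\ge0$, with some $\alpha,\beta,\gamma>0$. A density is called piecewise continuous on $(0,\infty)$ if it has finitely many discontinuities in every compact subinterval of $(0,\infty)$ and finite one-sided limits at every point of $(0,\infty)$. Suppose that for all $\omega\in\Omega$, $\varrho\in\mathfrak D$ and $T>0$ $$\mathcal V[\varrho](\omega)=\sup_{z\in\mathbb K,\;z(0)=\omega}\Big[\int_0^T\varrho(t)g(z(t))\,dt+\sup_{z_1\in\mathbb K,\;z_1(0)=z(T)}\int_0^\infty\varrho(t+T)g(z_1(t))\,dt\Big].$$ Then for every function $U_*:\Omega\to\mathbb R$ the following conditions are equivalent (all convergence is uniform in $\omega\in\Omega$): (c) for every density $\mu$ that is piecewise continuous on $(0,\infty)$, $\mathcal V[\mu^\lambda_{\rm scale}]\to U_*$ uniformly as $\lambda\to+0$; (u) $\mathcal V[\varpi_T]\to U_*$ uniformly as $T\to+\infty$; (e) $\mathcal V[\pi_\lambda]\to U_*$ uniformly as $\lambda\to+0$; (p) for some power density $\varrho$, $\mathcal V[\varrho^T_{\rm shift}]\to U_*$ uniformly as $T\to+\infty$; (q) for every power density $\varrho$, $\mathcal V[\varrho^T_{\rm shift}]\to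 U_*$ uniformly as $T\to+\infty$. In particular, if at least one of the limits $\lim_{T\to+\infty}\mathcal V[\varpi_T]$, $\lim_{\lambda\to+0}\mathcal V[\pi_\lambda]$, or $\lim_{T\to+\infty}\mathcal V[\varrho^T_{\rm shift}]$ for some power density $\varrho$, exists uniformly on $\Omega$, then these limits and the limits $\lim_{\lambda\to+0}\mathcal V[\mu^\lambda_{\rm scale}]$ all exist uniformly on $\Omega$, for all power densities $\varrho$ and all densities $\mu$ piecewise continuous on $(0,\infty)$, and they all coincide. -/

import Mathlib

open Set Filter Topology MeasureTheory
open scoped NNReal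

namespace ControlTauber

noncomputable section

/-- A probability density on `[0, ∞)`: Lebesgue measurable and non-negative on `[0, ∞)`, with
integral one there. It is written as a function of a real variable, and only its values at `t ≥ 0`
ever matter. (The integral being `1`, the function is integrable.) -/
def IsDensity (ρ : ℝ → ℝ) : Prop :=
  AEMeasurable ρ (volume.restrict (Ioi 0)) ∧ (∀ t, 0 ≤ t → 0 ≤ ρ t) ∧ ∫ t in Ioi 0, ρ t = 1

/-- The rescaled density `t ↦ a * ρ (a * t)`, for `a > 0`. -/
def scale (ρ : ℝ → ℝ) (a : ℝ) : ℝ → ℝ := fun t => a * ρ (a * t)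

/-- The shifted density `t ↦ ρ (t + T) / ∫_T^∞ ρ`, for `T > 0` with `∫_T^∞ ρ > 0`. -/
def shift (ρ : ℝ → ℝ) (T : ℝ) : ℝ → ℝ := fun t => ρ (t + T) / ∫ s in Ioi T, ρ s

/-- The density of the uniform distribution on `[0, T]`, for `T > 0`. -/
def uniformDensity (T : ℝ) : ℝ → ℝ := (Icc 0 T).indicator fun _ => 1 / T

/-- The density of the exponential distribution with rate `a > 0`. -/
def expDensity (a : ℝ) : ℝ → ℝ := fun t => a * Real.exp (-a * t)

/-- A power density: a density `t ↦ 1 / (α + β t) ^ γ` on `[0, ∞)` with `α, β, γ > 0`. -/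
def IsPowerDensity (ρ : ℝ → ℝ) : Prop :=
  IsDensity ρ ∧ ∃ α β γ : ℝ, 0 < α ∧ 0 < β ∧ 0 < γ ∧ ∀ t, 0 ≤ t → ρ t = 1 / (α + β * t) ^ γ

/-- Piecewise continuity on `(0, ∞)`: finitely many discontinuities in every compact subinterval
of `(0, ∞)`, and finite one-sided limits at every point of `(0, ∞)`. -/
def PiecewiseContinuousOnPos (f : ℝ → ℝ) : Prop :=
  (∀ a b, 0 < a → a ≤ b → {t | t ∈ Icc a b ∧ ¬ ContinuousAt f t}.Finite) ∧
  ∀ t, 0 < t → (∃ l, Tendsto f (𝓝[<] t) (𝓝 l)) ∧ (∃ r, Tendsto f (𝓝[>] t) (𝓝 r))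

/-- A density that is piecewise continuous on `(0, ∞)`. -/
def IsPiecewiseContinuousDensity (μ : ℝ → ℝ) : Prop :=
  IsDensity μ ∧ PiecewiseContinuousOnPos μ

variable {Ω : Type*}

/-- The supremum of the payoff `c` over all processes `z ∈ K` with `z 0 = ω`. -/
def supFrom (K : Set (ℝ≥0 → Ω)) (ω : Ω) (c : (ℝ≥0 → Ω) → ℝ) : ℝ :=
  sSup {x | ∃ z ∈ K, z 0 = ω ∧ c z = x}

/-- The payoff `∫_0^∞ ρ(t) g(z(t)) dt`. -/
def payoff (g : Ω → ℝ) (ρ : ℝ → ℝ) (z : ℝ≥0 → Ω) : ℝ :=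
  ∫ t in Ioi (0 : ℝ), ρ t * g (z t.toNNReal)

/-- The value `V[ρ](ω) = sup {∫_0^∞ ρ(t) g(z(t)) dt | z ∈ K, z(0) = ω}`. -/
def value (K : Set (ℝ≥0 → Ω)) (g : Ω → ℝ) (ρ : ℝ → ℝ) (ω : Ω) : ℝ :=
  supFrom K ω (payoff g ρ)

/-- The one-player dynamic programming principle, for all states, densities and times `T > 0`. -/
def DynamicProgramming (K : Set (ℝ≥0 → Ω)) (g : Ω → ℝ) : Prop :=
  ∀ (ω : Ω) (ρ : ℝ → ℝ), IsDensity ρ → ∀ T : ℝ, 0 < T →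
    value K g ρ ω = supFrom K ω fun z =>
      (∫ t in Ioc 0 T, ρ t * g (z t.toNNReal)) +
        supFrom K (z T.toNNReal) fun z₁ => ∫ t in Ioi (0 : ℝ), ρ (t + T) * g (z₁ t.toNNReal)

end

end ControlTauber

open ControlTauber

namespace ControlTauber

variable {Ω : Type*} {K : Set (ℝ≥0 → Ω)} {g : Ω → ℝ}

/-! ### Integrals over the half-line -/

/-! The uniform densities are the hub of all the implications. By dynamic programming, two weights
that are L¹-close on `[0, t]` and whose tails have nearly equal values at every state have nearly
equal values (`abs_value_sub_le_of_shift`); the tails themselves may be far apart. Such comparisons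
survive rescaling, and `EventuallyNear` records them: a weight of mass `m` has rescaled values near
`m * U`.

From exponential or power densities to uniform ones (`uniformDensity_of_selfSimilar`): normalized so
that `φ(0+) = 1`, the density `φ` nearly matches the indicator of `[0, 1]` on a short `[0, t]`, and
both tails are multiples of rescalings of the original weights, of mass about `1 - t`. If `d` is the
best asymptotic error for the uniform densities, this gives `d ≤ (1 - t) * d + o(t)`, hence `d = 0`.

From uniform densities to any density (`of_oscillation`, `of_uniformDensity`): approximate in L¹ by
a continuous `f` of compact support and cut time into short steps. On one step `f` is close to a
block of constant height, whose length is chosen so that both tails have the same mass. The tail of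
the block is again a block, and the tail of `f` is covered by induction.

Shifting a power density amounts to rescaling it, so shift limits are scale limits in another
parameter. -/

lemma integrableOn_shift {f : ℝ → ℝ} (hf : IntegrableOn f (Ioi 0)) {t : ℝ} (ht : 0 ≤ t) :
    IntegrableOn (fun x => f (x + t)) (Ioi 0) := by
  have h := (measurePreserving_add_right volume t).integrableOn_comp_preimage
    (measurableEmbedding_addRight t) (f := f) (s := Ioi t)
  rw [preimage_add_const_Ioi, sub_self] at h
  exact h.2 (hf.mono_set (Ioi_subset_Ioi ht))

lemma setIntegral_Ioi_shift (f : ℝ → ℝ) (t : ℝ) :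
    ∫ x in Ioi 0, f (x + t) = ∫ x in Ioi t, f x := by
  have h := (measurePreserving_add_right volume t).setIntegral_preimage_emb
    (measurableEmbedding_addRight t) f (Ioi t)
  rwa [preimage_add_const_Ioi, sub_self] at h

lemma setIntegral_Ioc_add_shift {f : ℝ → ℝ} (hf : IntegrableOn f (Ioi 0)) {t : ℝ} (ht : 0 ≤ t) :
    (∫ x in Ioc 0 t, f x) + ∫ x in Ioi 0, f (x + t) = ∫ x in Ioi 0, f x := by
  rw [setIntegral_Ioi_shift, ← setIntegral_union Ioc_disjoint_Ioi_same measurableSet_Ioi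
    (hf.mono_set Ioc_subset_Ioi_self) (hf.mono_set (Ioi_subset_Ioi ht)), Ioc_union_Ioi_eq_Ioi ht]

lemma integrableOn_scale {f : ℝ → ℝ} (hf : IntegrableOn f (Ioi 0)) {a : ℝ} (ha : 0 < a) :
    IntegrableOn (scale f a) (Ioi 0) := by
  refine Integrable.const_mul ?_ a
  rw [← IntegrableOn, integrableOn_Ioi_comp_mul_left_iff f 0 ha, mul_zero]
  exact hf

lemma setIntegral_scale (f : ℝ → ℝ) {a : ℝ} (ha : 0 < a) :
    ∫ x in Ioi 0, scale f a x = ∫ x in Ioi 0, f x := by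
  simp only [scale]
  rw [integral_const_mul, integral_comp_mul_left_Ioi f 0 ha, mul_zero, smul_eq_mul,
    mul_inv_cancel_left₀ ha.ne']

/-- A non-integrable function has the default integral 0, not 1. -/
lemma IsDensity.integrableOn {ρ : ℝ → ℝ} (h : IsDensity ρ) : IntegrableOn ρ (Ioi 0) := by
  by_contra h'
  have := h.2.2
  rw [integral_undef h'] at this
  exact zero_ne_one this

/-! ### Values -/

lemma supFrom_congr {ω : Ω} {c c' : (ℝ≥0 → Ω) → ℝ} (h : ∀ z ∈ K, z 0 = ω → c z = c' z) :
    supFrom K ω c = supFrom K ω c' := by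
  unfold supFrom
  congr 1
  ext x
  constructor
  · rintro ⟨z, hz, h0, rfl⟩
    exact ⟨z, hz, h0, (h z hz h0).symm⟩
  · rintro ⟨z, hz, h0, rfl⟩
    exact ⟨z, hz, h0, h z hz h0⟩

/-- No bound on `c` is needed: if `b > 0` and the payoffs are unbounded above, both suprema take the
default value 0. -/
lemma supFrom_const_mul {ω : Ω} {b : ℝ} (hb : 0 ≤ b) (c : (ℝ≥0 → Ω) → ℝ) :
    supFrom K ω (fun z => b * c z) = b * supFrom K ω c := by
  unfold supFrom
  rw [← smul_eq_mul, ← Real.sSup_smul_of_nonneg hb]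
  congr 1
  ext x
  simp only [mem_smul_set, mem_ofPred_eq, smul_eq_mul]
  constructor
  · rintro ⟨z, hz, h0, rfl⟩
    exact ⟨_, ⟨z, hz, h0, rfl⟩, rfl⟩
  · rintro ⟨_, ⟨z, hz, h0, rfl⟩, rfl⟩
    exact ⟨z, hz, h0, rfl⟩

lemma supFrom_le (hstart : ∀ ω, ∃ z ∈ K, z 0 = ω) {ω : Ω} {c : (ℝ≥0 → Ω) → ℝ} {b : ℝ}
    (h : ∀ z ∈ K, z 0 = ω → c z ≤ b) : supFrom K ω c ≤ b := by
  obtain ⟨z, hz, h0⟩ := hstart ω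
  refine csSup_le ⟨_, z, hz, h0, rfl⟩ ?_
  rintro x ⟨z, hz, h0, rfl⟩
  exact h z hz h0

lemma le_supFrom {ω : Ω} {c : (ℝ≥0 → Ω) → ℝ} {b : ℝ}
    (h : ∀ z ∈ K, z 0 = ω → c z ≤ b) {z : ℝ≥0 → Ω} (hz : z ∈ K) (h0 : z 0 = ω) :
    c z ≤ supFrom K ω c := by
  refine le_csSup ⟨b, ?_⟩ ⟨z, hz, h0, rfl⟩
  rintro x ⟨z, hz, h0, rfl⟩
  exact h z hz h0

/-- The bound on `c` passes to `c'` at the cost of `δ`, so both suprema are genuine. -/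
lemma abs_supFrom_sub_le (hstart : ∀ ω, ∃ z ∈ K, z 0 = ω) {ω : Ω} {c c' : (ℝ≥0 → Ω) → ℝ}
    {b δ : ℝ} (hb : ∀ z ∈ K, z 0 = ω → c z ≤ b)
    (h : ∀ z ∈ K, z 0 = ω → |c z - c' z| ≤ δ) :
    |supFrom K ω c - supFrom K ω c'| ≤ δ := by
  have hb' : ∀ z ∈ K, z 0 = ω → c' z ≤ b + δ := fun z hz h0 => by
    linarith [abs_le.1 (h z hz h0), hb z hz h0]
  rw [abs_sub_le_iff, sub_le_iff_le_add, sub_le_iff_le_add]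
  constructor
  · exact supFrom_le hstart fun z hz h0 => by
      linarith [abs_le.1 (h z hz h0), le_supFrom hb' hz h0]
  · exact supFrom_le hstart fun z hz h0 => by
      linarith [abs_le.1 (h z hz h0), le_supFrom hb hz h0]

/-- A control system whose running payoff takes values in `[0, 1]`, is measurable along processes,
and in which every state is the initial state of a process. -/
structure IsPayoffSystem (K : Set (ℝ≥0 → Ω)) (g : Ω → ℝ) : Prop where
  mem_Icc : ∀ ω, g ω ∈ Icc (0 : ℝ) 1
  aemeasurable : ∀ z ∈ K, AEMeasurable (fun t : ℝ => g (z t.toNNReal)) (volume.restrict (Ioi 0))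
  start : ∀ ω, ∃ z ∈ K, z 0 = ω

lemma value_congr {ρ σ : ℝ → ℝ} (h : EqOn ρ σ (Ioi 0)) (ω : Ω) :
    value K g ρ ω = value K g σ ω :=
  supFrom_congr fun z _ _ => setIntegral_congr_fun measurableSet_Ioi fun t ht => by
    simp only [h ht]

lemma value_const_mul {b : ℝ} (hb : 0 ≤ b) (ρ : ℝ → ℝ) (ω : Ω) :
    value K g (fun t => b * ρ t) ω = b * value K g ρ ω := by
  rw [value, value, ← supFrom_const_mul hb]
  refine supFrom_congr fun z _ _ => ?_
  simp only [payoff, mul_assoc]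
  rw [integral_const_mul]

lemma value_zero (ω : Ω) : value K g (fun _ => 0) ω = 0 := by
  have h := value_const_mul (K := K) (g := g) le_rfl (fun _ => 0) ω
  simpa using h

namespace IsPayoffSystem

lemma integrableOn_mul (S : IsPayoffSystem K g) {z : ℝ≥0 → Ω} (hz : z ∈ K) {ρ : ℝ → ℝ}
    (hρ : IntegrableOn ρ (Ioi 0)) :
    IntegrableOn (fun t => ρ t * g (z t.toNNReal)) (Ioi 0) := by
  refine Integrable.mul_bdd (c := 1) hρ (S.aemeasurable z hz).aestronglyMeasurable ?_
  refine Eventually.of_forall fun t => ?_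
  rw [Real.norm_eq_abs, abs_of_nonneg (S.mem_Icc _).1]
  exact (S.mem_Icc _).2

lemma abs_setIntegral_sub_le (S : IsPayoffSystem K g) {z : ℝ≥0 → Ω} (hz : z ∈ K) {ρ σ : ℝ → ℝ}
    (hρ : IntegrableOn ρ (Ioi 0)) (hσ : IntegrableOn σ (Ioi 0)) {s : Set ℝ} (hs : s ⊆ Ioi 0) :
    |(∫ t in s, ρ t * g (z t.toNNReal)) - ∫ t in s, σ t * g (z t.toNNReal)|
      ≤ ∫ t in s, |ρ t - σ t| := by
  rw [← integral_sub ((S.integrableOn_mul hz hρ).mono_set hs)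
    ((S.integrableOn_mul hz hσ).mono_set hs)]
  refine (abs_integral_le_integral_abs).trans ?_
  refine integral_mono (((S.integrableOn_mul hz hρ).sub (S.integrableOn_mul hz hσ)).mono_set hs).abs
    ((hρ.sub hσ).mono_set hs).abs fun t => ?_
  simp only
  rw [← sub_mul, abs_mul, abs_of_nonneg (S.mem_Icc _).1]
  exact mul_le_of_le_one_right (abs_nonneg _) (S.mem_Icc _).2

lemma setIntegral_le (S : IsPayoffSystem K g) {z : ℝ≥0 → Ω} (hz : z ∈ K) {ρ : ℝ → ℝ}
    (hρ : IntegrableOn ρ (Ioi 0)) {s : Set ℝ} (hs : s ⊆ Ioi 0) :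
    ∫ t in s, ρ t * g (z t.toNNReal) ≤ ∫ t in s, |ρ t| := by
  have h := S.abs_setIntegral_sub_le hz hρ (integrableOn_zero (s := Ioi 0)) hs
  simp only [zero_mul, integral_zero, sub_zero] at h
  exact (le_abs_self _).trans h

/-- Since `0 ≤ g ≤ 1`, no single process separates the two payoffs by more than the L¹ distance of
the weights. This justifies replacing a density by a continuous approximation. -/
lemma abs_value_sub_le (S : IsPayoffSystem K g) {ρ σ : ℝ → ℝ}
    (hρ : IntegrableOn ρ (Ioi 0)) (hσ : IntegrableOn σ (Ioi 0)) (ω : Ω) :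
    |value K g ρ ω - value K g σ ω| ≤ ∫ t in Ioi 0, |ρ t - σ t| :=
  abs_supFrom_sub_le S.start (fun _ hz _ => S.setIntegral_le hz hρ subset_rfl)
    fun _ hz _ => S.abs_setIntegral_sub_le hz hρ hσ subset_rfl

lemma value_le (S : IsPayoffSystem K g) {ρ : ℝ → ℝ} (hρ : IntegrableOn ρ (Ioi 0)) (ω : Ω) :
    value K g ρ ω ≤ ∫ t in Ioi 0, |ρ t| :=
  supFrom_le S.start fun _ hz _ => S.setIntegral_le hz hρ subset_rfl

lemma value_nonneg (S : IsPayoffSystem K g) {ρ : ℝ → ℝ}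
    (h0 : ∀ t, 0 ≤ t → 0 ≤ ρ t) (ω : Ω) : 0 ≤ value K g ρ ω := by
  refine Real.sSup_nonneg ?_
  rintro x ⟨z, hz, -, rfl⟩
  exact setIntegral_nonneg measurableSet_Ioi fun t ht =>
    mul_nonneg (h0 t (le_of_lt ht)) (S.mem_Icc _).1

/-- The dynamic programming principle for weights of positive mass. -/
lemma value_eq_supFrom (hDPP : DynamicProgramming K g) {ρ : ℝ → ℝ} (hρ : IntegrableOn ρ (Ioi 0))
    (h0 : ∀ t, 0 ≤ t → 0 ≤ ρ t) (hpos : 0 < ∫ t in Ioi 0, ρ t) {T : ℝ} (hT : 0 < T) (ω : Ω) :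
    value K g ρ ω = supFrom K ω fun z =>
      (∫ t in Ioc 0 T, ρ t * g (z t.toNNReal)) +
        value K g (fun t => ρ (t + T)) (z T.toNNReal) := by
  set m := ∫ t in Ioi 0, ρ t with hm
  have hd : IsDensity fun t => m⁻¹ * ρ t := by
    refine ⟨(hρ.const_mul m⁻¹).aestronglyMeasurable.aemeasurable,
      fun t ht => mul_nonneg (inv_nonneg.2 hpos.le) (h0 t ht), ?_⟩
    rw [integral_const_mul, ← hm, inv_mul_cancel₀ hpos.ne']
  have h := hDPP ω _ hd T hT
  -- The inner supremum of the principle is by definition the value of the shifted weight.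
  change _ = supFrom K ω fun z => _ + value K g (fun t => m⁻¹ * ρ (t + T)) (z T.toNNReal) at h
  simp only [value_const_mul (inv_nonneg.2 hpos.le), mul_assoc, integral_const_mul,
    ← mul_add] at h
  rw [supFrom_const_mul (inv_nonneg.2 hpos.le)] at h
  exact mul_left_cancel₀ (inv_ne_zero hpos.ne') h

/-- Along one process the payoffs up to `T` differ by at most the L¹ distance there, and both
continuations start from the same state `z(T)`. Only the values of the tails are compared, never the
tails. -/
lemma abs_value_sub_le_of_shift (S : IsPayoffSystem K g) (hDPP : DynamicProgramming K g)
    {ρ σ : ℝ → ℝ} (hρ : IntegrableOn ρ (Ioi 0)) (hρ0 : ∀ t, 0 ≤ t → 0 ≤ ρ t)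
    (hρp : 0 < ∫ t in Ioi 0, ρ t) (hσ : IntegrableOn σ (Ioi 0)) (hσ0 : ∀ t, 0 ≤ t → 0 ≤ σ t)
    (hσp : 0 < ∫ t in Ioi 0, σ t) {T δ : ℝ} (hT : 0 < T)
    (h : ∀ ω, |value K g (fun t => ρ (t + T)) ω - value K g (fun t => σ (t + T)) ω| ≤ δ) (ω : Ω) :
    |value K g ρ ω - value K g σ ω| ≤ (∫ t in Ioc 0 T, |ρ t - σ t|) + δ := by
  rw [value_eq_supFrom hDPP hρ hρ0 hρp hT, value_eq_supFrom hDPP hσ hσ0 hσp hT]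
  refine abs_supFrom_sub_le S.start (fun z hz _ => add_le_add
    (S.setIntegral_le hz hρ Ioc_subset_Ioi_self)
    (S.value_le (integrableOn_shift hρ hT.le) _)) fun z hz _ => ?_
  rw [add_sub_add_comm]
  exact (abs_add_le _ _).trans (add_le_add
    (S.abs_setIntegral_sub_le hz hρ hσ Ioc_subset_Ioi_self) (h _))

end IsPayoffSystem

/-! ### Approximate limits of values under rescaling -/

/-- The values of the rescaled weights `scale ρ a` are eventually within `δ` of `m * U`,
uniformly in the state, as `a → 0+`. -/
def EventuallyNear (K : Set (ℝ≥0 → Ω)) (g : Ω → ℝ) (U : Ω → ℝ) (ρ : ℝ → ℝ) (m δ : ℝ) : Prop :=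
  ∀ᶠ a in 𝓝[>] (0 : ℝ), ∀ ω, |value K g (scale ρ a) ω - m * U ω| ≤ δ

lemma tendstoUniformly_scale_iff {ρ : ℝ → ℝ} {U : Ω → ℝ} :
    TendstoUniformly (fun a => value K g (scale ρ a)) U (𝓝[>] 0) ↔
      ∀ δ, 0 < δ → EventuallyNear K g U ρ 1 δ := by
  rw [Metric.tendstoUniformly_iff]
  constructor
  · intro h δ hδ
    filter_upwards [h δ hδ] with a ha ω
    have := ha ω
    rw [dist_comm, Real.dist_eq] at this
    simpa using this.le
  · intro h δ hδ
    filter_upwards [h (δ / 2) (half_pos hδ)] with a ha ω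
    have := ha ω
    rw [one_mul] at this
    rw [dist_comm, Real.dist_eq]
    exact this.trans_lt (half_lt_self hδ)

/-- Time `t` for the original weight becomes time `t / a` after rescaling; dynamic programming is
applied at that time. -/
lemma scale_shift_apply (ρ : ℝ → ℝ) {a : ℝ} (ha : 0 < a) (t x : ℝ) :
    scale ρ a (x + t / a) = scale (fun y => ρ (y + t)) a x := by
  simp only [scale, mul_add, mul_div_cancel₀ t ha.ne']

lemma setIntegral_abs_scale_sub (ρ σ : ℝ → ℝ) {a t : ℝ} (ha : 0 < a) (ht : 0 ≤ t) :
    ∫ x in Ioc 0 (t / a), |scale ρ a x - scale σ a x| = ∫ x in Ioc 0 t, |ρ x - σ x| := by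
  have h := intervalIntegral.mul_integral_comp_mul_left (a := 0) (b := t / a)
    (f := fun x => |ρ x - σ x|) a
  rw [mul_zero, mul_div_cancel₀ t ha.ne', intervalIntegral.integral_of_le (div_nonneg ht ha.le),
    intervalIntegral.integral_of_le ht, ← integral_const_mul] at h
  rw [← h]
  refine integral_congr_ae (Eventually.of_forall fun x => ?_)
  simp only [scale, ← mul_sub, abs_mul, abs_of_pos ha]

namespace EventuallyNear

variable {U : Ω → ℝ} {ρ σ : ℝ → ℝ} {m m' m₁ m₂ δ δ' δ₁ δ₂ δ₃ : ℝ}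

lemma mono (h : EventuallyNear K g U ρ m δ) (hδ : δ ≤ δ') : EventuallyNear K g U ρ m δ' := by
  filter_upwards [h] with a ha ω
  exact (ha ω).trans hδ

lemma congr (h : EventuallyNear K g U ρ m δ) (hρ : EqOn ρ σ (Ioi 0)) :
    EventuallyNear K g U σ m δ := by
  filter_upwards [h, self_mem_nhdsWithin] with a ha ha0 ω
  rw [← value_congr (ρ := scale ρ a) (fun t ht => ?_)]
  · exact ha ω
  · simp only [scale]
    rw [hρ (mul_pos ha0 ht : 0 < a * t)]

lemma const_mul (h : EventuallyNear K g U ρ m δ) {b : ℝ} (hb : 0 ≤ b) :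
    EventuallyNear K g U (fun t => b * ρ t) (b * m) (b * δ) := by
  filter_upwards [h] with a ha ω
  have : scale (fun t => b * ρ t) a = fun t => b * scale ρ a t := by
    funext t
    simp only [scale]
    ring
  rw [this, value_const_mul hb, mul_assoc, ← mul_sub, abs_mul, abs_of_nonneg hb]
  exact mul_le_mul_of_nonneg_left (ha ω) hb

lemma scale (h : EventuallyNear K g U ρ m δ) {s : ℝ} (hs : 0 < s) :
    EventuallyNear K g U (scale ρ s) m δ := by
  have ht : Tendsto (fun a => s * a) (𝓝[>] (0 : ℝ)) (𝓝[>] 0) := by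
    refine tendsto_nhdsWithin_iff.2 ⟨?_, ?_⟩
    · have : Tendsto (fun a => s * a) (𝓝 (0 : ℝ)) (𝓝 (s * 0)) := tendsto_id.const_mul s
      rw [mul_zero] at this
      exact this.mono_left nhdsWithin_le_nhds
    · filter_upwards [self_mem_nhdsWithin] with a ha using mul_pos hs ha
  filter_upwards [ht.eventually h] with a ha ω
  have : ControlTauber.scale (ControlTauber.scale ρ s) a = ControlTauber.scale ρ (s * a) := by
    funext t
    simp only [ControlTauber.scale]
    ring_nf
  rw [this]
  exact ha ω

lemma zero (hδ : 0 ≤ δ) : EventuallyNear K g U (fun _ => 0) 0 δ := by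
  refine Eventually.of_forall fun a ω => ?_
  have : ControlTauber.scale (fun _ => (0 : ℝ)) a = fun _ => 0 := by
    funext t
    simp [ControlTauber.scale]
  rw [this, value_zero]
  simpa using hδ

lemma mass (h : EventuallyNear K g U ρ m δ) (hU : ∀ ω, U ω ∈ Icc (0 : ℝ) 1)
    (hm : |m - m'| ≤ δ') : EventuallyNear K g U ρ m' (δ + δ') := by
  filter_upwards [h] with a ha ω
  have : value K g (ControlTauber.scale ρ a) ω - m' * U ω =
    (value K g (ControlTauber.scale ρ a) ω - m * U ω) + (m - m') * U ω := by ring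
  rw [this]
  refine (abs_add_le _ _).trans (add_le_add (ha ω) ?_)
  rw [abs_mul, abs_of_nonneg (hU ω).1]
  exact (mul_le_of_le_one_right (abs_nonneg _) (hU ω).2).trans hm

lemma approx (S : IsPayoffSystem K g) (h : EventuallyNear K g U σ m δ)
    (hρ : IntegrableOn ρ (Ioi 0)) (hσ : IntegrableOn σ (Ioi 0))
    (hd : ∫ t in Ioi 0, |ρ t - σ t| ≤ δ') : EventuallyNear K g U ρ m (δ + δ') := by
  filter_upwards [h, self_mem_nhdsWithin] with a ha ha0 ω
  have h1 := S.abs_value_sub_le (integrableOn_scale hρ ha0) (integrableOn_scale hσ ha0) ω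
  have h2 : ∫ t in Ioi 0, |ControlTauber.scale ρ a t - ControlTauber.scale σ a t|
      = ∫ t in Ioi 0, |ρ t - σ t| := by
    rw [← setIntegral_scale (fun t => |ρ t - σ t|) ha0]
    refine integral_congr_ae (Eventually.of_forall fun x => ?_)
    simp only [ControlTauber.scale, ← mul_sub, abs_mul, abs_of_pos (show 0 < a from ha0)]
  rw [add_comm]
  calc _ ≤ _ := abs_sub_le _ (value K g (ControlTauber.scale σ a) ω) _
    _ ≤ _ := add_le_add (h1.trans (h2.le.trans hd)) (ha ω)

/-- Weights that agree up to time `t`, and whose continuations have near values, have near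
values. -/
lemma of_shift (S : IsPayoffSystem K g) (hDPP : DynamicProgramming K g)
    (hρ : IntegrableOn ρ (Ioi 0)) (hρ0 : ∀ t, 0 ≤ t → 0 ≤ ρ t)
    (hρp : 0 < ∫ t in Ioi 0, ρ t) (hσ : IntegrableOn σ (Ioi 0)) (hσ0 : ∀ t, 0 ≤ t → 0 ≤ σ t)
    (hσp : 0 < ∫ t in Ioi 0, σ t) {t : ℝ} (ht : 0 < t)
    (h₁ : EventuallyNear K g U (fun x => ρ (x + t)) m₁ δ₁)
    (h₂ : EventuallyNear K g U (fun x => σ (x + t)) m₁ δ₂)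
    (h₃ : EventuallyNear K g U σ m₂ δ₃) :
    EventuallyNear K g U ρ m₂ ((∫ x in Ioc 0 t, |ρ x - σ x|) + (δ₁ + δ₂) + δ₃) := by
  filter_upwards [h₁, h₂, h₃, self_mem_nhdsWithin] with a ha₁ ha₂ ha₃ ha ω
  replace ha : 0 < a := ha
  -- Both tails are near the same `m₁ * U`, so their values differ by at most `δ₁ + δ₂`.
  have key := S.abs_value_sub_le_of_shift hDPP (ρ := ControlTauber.scale ρ a)
    (σ := ControlTauber.scale σ a) (T := t / a) (δ := δ₁ + δ₂) (integrableOn_scale hρ ha)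
    (fun t ht => mul_nonneg ha.le (hρ0 _ (mul_nonneg ha.le ht)))
    (by rwa [setIntegral_scale ρ ha]) (integrableOn_scale hσ ha)
    (fun t ht => mul_nonneg ha.le (hσ0 _ (mul_nonneg ha.le ht)))
    (by rwa [setIntegral_scale σ ha]) (div_pos ht ha) (fun ω' => by
      simp only [scale_shift_apply _ ha]
      have h1 := abs_le.1 (ha₁ ω')
      have h2 := abs_le.1 (ha₂ ω')
      exact abs_le.2 ⟨by linarith, by linarith⟩) ω
  rw [setIntegral_abs_scale_sub ρ σ ha ht.le] at key
  calc _ ≤ _ := abs_sub_le _ (value K g (ControlTauber.scale σ a) ω) _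
    _ ≤ _ := add_le_add key (ha₃ ω)

end EventuallyNear

lemma mem_Icc_of_tendstoUniformly (S : IsPayoffSystem K g) {ρ : ℝ → ℝ} (hρ : IsDensity ρ)
    {U : Ω → ℝ} (h : TendstoUniformly (fun a => value K g (scale ρ a)) U (𝓝[>] 0)) (ω : Ω) :
    U ω ∈ Icc (0 : ℝ) 1 := by
  refine isClosed_Icc.mem_of_tendsto (h.tendsto_at ω) ?_
  filter_upwards [self_mem_nhdsWithin] with a (ha : 0 < a)
  have h0 : ∀ t, 0 ≤ t → 0 ≤ scale ρ a t := fun t ht =>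
    mul_nonneg ha.le (hρ.2.1 _ (mul_nonneg ha.le ht))
  refine ⟨S.value_nonneg h0 ω, (S.value_le (integrableOn_scale hρ.integrableOn ha) ω).trans ?_⟩
  rw [← hρ.2.2, ← setIntegral_scale ρ ha]
  refine (setIntegral_congr_fun measurableSet_Ioi fun t ht => ?_).le
  exact abs_of_nonneg (h0 t (le_of_lt ht))

/-! ### Uniform densities -/

lemma integrableOn_uniformDensity (T : ℝ) : IntegrableOn (uniformDensity T) (Ioi 0) := by
  have h : Integrable (uniformDensity T) := by
    unfold uniformDensity
    rw [integrable_indicator_iff measurableSet_Icc]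
    exact integrableOn_const (by simp)
  exact h.integrableOn

lemma uniformDensity_nonneg {T : ℝ} (hT : 0 ≤ T) (t : ℝ) : 0 ≤ uniformDensity T t :=
  indicator_nonneg (fun _ _ => by positivity) t

lemma uniformDensity_of_mem {T t : ℝ} (ht : t ∈ Icc 0 T) : uniformDensity T t = 1 / T :=
  indicator_of_mem ht _

lemma uniformDensity_of_lt {T t : ℝ} (ht : T < t) : uniformDensity T t = 0 :=
  indicator_of_notMem (fun h => (h.2.trans_lt ht).false) _

lemma setIntegral_uniformDensity {T : ℝ} (hT : 0 < T) : ∫ t in Ioi 0, uniformDensity T t = 1 := by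
  unfold uniformDensity
  rw [setIntegral_indicator measurableSet_Icc, setIntegral_const]
  have : Ioi 0 ∩ Icc 0 T = Ioc 0 T := by
    ext x
    simp only [mem_inter_iff, mem_Ioi, mem_Icc, mem_Ioc]
    exact ⟨fun h => ⟨h.1, h.2.2⟩, fun h => ⟨h.1, h.1.le, h.2⟩⟩
  rw [this, Real.volume_real_Ioc_of_le hT.le, sub_zero, smul_eq_mul, mul_one_div_cancel hT.ne']

lemma isDensity_uniformDensity {T : ℝ} (hT : 0 < T) : IsDensity (uniformDensity T) :=
  ⟨(integrableOn_uniformDensity T).aestronglyMeasurable.aemeasurable,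
    fun t _ => uniformDensity_nonneg hT.le t, setIntegral_uniformDensity hT⟩

lemma scale_uniformDensity_one {a t : ℝ} (ha : 0 < a) (ht : 0 < t) :
    scale (uniformDensity 1) a t = uniformDensity a⁻¹ t := by
  simp only [scale]
  rcases le_or_gt t a⁻¹ with h | h
  · rw [uniformDensity_of_mem ⟨ht.le, h⟩, uniformDensity_of_mem ⟨by positivity, ?_⟩]
    · simp
    · calc a * t ≤ a * a⁻¹ := by gcongr
        _ = 1 := mul_inv_cancel₀ ha.ne'
  · rw [uniformDensity_of_lt h, uniformDensity_of_lt, mul_zero]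
    calc 1 = a * a⁻¹ := (mul_inv_cancel₀ ha.ne').symm
      _ < a * t := by gcongr

/-- Without normalization a block stays a block under shifting. For `t ≥ T` both sides vanish. -/
lemma uniformDensity_shift {T t x : ℝ} (ht : 0 < t) (hx : 0 < x) :
    T * uniformDensity T (x + t) = (T - t) * uniformDensity (T - t) x := by
  rcases le_or_gt x (T - t) with h | h
  · rw [uniformDensity_of_mem ⟨by linarith, by linarith⟩, uniformDensity_of_mem ⟨hx.le, h⟩,
      mul_one_div_cancel (by linarith), mul_one_div_cancel (by linarith)]
  · rw [uniformDensity_of_lt h, uniformDensity_of_lt (by linarith), mul_zero, mul_zero]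

namespace EventuallyNear

variable {U : Ω → ℝ}

lemma forall_const_mul {ρ : ℝ → ℝ} {m b : ℝ} (h : ∀ δ, 0 < δ → EventuallyNear K g U ρ m δ)
    (hb : 0 ≤ b) {δ : ℝ} (hδ : 0 < δ) : EventuallyNear K g U (fun t => b * ρ t) (b * m) δ := by
  refine ((h (δ / (b + 1)) (by positivity)).const_mul hb).mono ?_
  rw [mul_div_assoc', div_le_iff₀ (by positivity)]
  nlinarith

/-- The weight is a block of height `b` on `[0, T]`. The case `T = 0` occurs as the tail of a block
that is used up. -/
lemma const_mul_uniformDensity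
    (hu : ∀ δ, 0 < δ → EventuallyNear K g U (uniformDensity 1) 1 δ) {T b : ℝ} (hT : 0 ≤ T)
    (hb : 0 ≤ b) {δ : ℝ} (hδ : 0 < δ) :
    EventuallyNear K g U (fun t => b * T * uniformDensity T t) (b * T) δ := by
  rcases hT.eq_or_lt with rfl | hT
  · simpa using EventuallyNear.zero hδ.le
  · have h : ∀ δ, 0 < δ → EventuallyNear K g U (uniformDensity T) 1 δ := fun δ hδ =>
      ((hu δ hδ).scale (inv_pos.2 hT)).congr fun t ht => by
        rw [scale_uniformDensity_one (inv_pos.2 hT) ht, inv_inv]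
    simpa using forall_const_mul h (mul_nonneg hb hT.le) hδ

/-- If the values of the rescaled `φ` converge, where the shifts of `φ` are multiples of
rescalings of `φ` and `φ → 1` at `0+`, then the values of the uniform densities converge to the
same limit. -/
theorem uniformDensity_of_selfSimilar (S : IsPayoffSystem K g) (hDPP : DynamicProgramming K g)
    {φ : ℝ → ℝ} (hφ : IsDensity φ) (hφ1 : Tendsto φ (𝓝[>] 0) (𝓝 1))
    (hshift : ∀ t, 0 < t → ∃ c s, 0 ≤ c ∧ 0 < s ∧ ∀ x, 0 < x → φ (x + t) = c * φ (s * x))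
    (hU : ∀ ω, U ω ∈ Icc (0 : ℝ) 1) (h : ∀ δ, 0 < δ → EventuallyNear K g U φ 1 δ) :
    ∀ δ, 0 < δ → EventuallyNear K g U (uniformDensity 1) 1 δ := by
  intro δ₀ hδ₀
  by_contra hcon
  set D : Set ℝ := {δ | EventuallyNear K g U (uniformDensity 1) 1 δ} with hD
  have hlow : ∀ δ ∈ D, δ₀ ≤ δ := fun δ hδ => by
    by_contra! hlt
    exact hcon (EventuallyNear.mono hδ hlt.le)
  have hbdd : BddBelow D := ⟨δ₀, hlow⟩
  -- The error 1 is always admissible, as the values and `U` lie in `[0, 1]`.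
  have hne : D.Nonempty := by
    refine ⟨1, ?_⟩
    change ∀ᶠ a in 𝓝[>] (0 : ℝ), _
    filter_upwards [self_mem_nhdsWithin] with a (ha : 0 < a) ω
    have h0 : ∀ t, 0 ≤ t → 0 ≤ ControlTauber.scale (uniformDensity 1) a t := fun t _ =>
      mul_nonneg ha.le (uniformDensity_nonneg zero_le_one _)
    have h1 := S.value_nonneg h0 ω
    have h2 := S.value_le (integrableOn_scale (integrableOn_uniformDensity 1) ha) ω
    rw [setIntegral_congr_fun measurableSet_Ioi fun t (ht : 0 < t) => abs_of_nonneg (h0 t ht.le),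
      setIntegral_scale _ ha, setIntegral_uniformDensity one_pos] at h2
    have h3 := hU ω
    rw [one_mul]
    exact abs_le.2 ⟨by linarith [h3.2], by linarith [h3.1]⟩
  set d := sInf D with hd
  have hd0 : δ₀ ≤ d := le_csInf hne hlow
  -- The comparison below costs at most `5 * t * η`, while the factor `1 - t` gains `t * d ≥ 8 * t *
  -- η`.
  set η := δ₀ / 8 with hη
  have hη0 : 0 < η := by positivity
  obtain ⟨t, ht0, ht1, hclose⟩ : ∃ t, 0 < t ∧ t < 1 ∧ ∀ x ∈ Ioc 0 t, |φ x - 1| ≤ η := by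
    have h1 : ∀ᶠ x in 𝓝[>] (0 : ℝ), |φ x - 1| < η := by
      filter_upwards [Metric.tendsto_nhds.1 hφ1 η hη0] with x hx using hx
    obtain ⟨u, hu, hu'⟩ := mem_nhdsGT_iff_exists_Ioc_subset.1 h1
    refine ⟨min u (1 / 2), lt_min hu (by norm_num), (min_le_right _ _).trans_lt (by norm_num), ?_⟩
    intro x hx
    exact (hu' ⟨hx.1, hx.2.trans (min_le_left _ _)⟩ : |φ x - 1| < η).le
  have htη : 0 < t * η := mul_pos ht0 hη0
  have hvol : volume.real (Ioc 0 t) = t := by rw [Real.volume_real_Ioc_of_le ht0.le, sub_zero]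
  obtain ⟨δ, hδD, hδ⟩ := exists_lt_of_csInf_lt hne (lt_add_of_pos_right d htη)
  -- the shifted uniform density
  have h₁ : EventuallyNear K g U (fun x => uniformDensity 1 (x + t)) (1 - t) ((1 - t) * δ) := by
    have h2 := ((EventuallyNear.scale hδD (inv_pos.2 (sub_pos.2 ht1))).const_mul
      (sub_pos.2 ht1).le)
    rw [mul_one] at h2
    refine h2.congr fun x hx => ?_
    simp only
    rw [scale_uniformDensity_one (inv_pos.2 (sub_pos.2 ht1)) hx, inv_inv,
      ← uniformDensity_shift ht0 hx, one_mul]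
  -- the shifted self-similar density
  obtain ⟨c, s, hc, hs, hcs⟩ := hshift t ht0
  have heq : EqOn (fun x => c / s * ControlTauber.scale φ s x) (fun x => φ (x + t)) (Ioi 0) := by
    intro x hx
    simp only [ControlTauber.scale]
    rw [hcs x hx]
    field_simp
  have hmass : ∫ x in Ioi 0, φ (x + t) = c / s := by
    rw [← setIntegral_congr_fun measurableSet_Ioi heq, integral_const_mul, setIntegral_scale φ hs,
      hφ.2.2, mul_one]
  have h₂ : EventuallyNear K g U (fun x => φ (x + t)) (c / s) (t * η) := by
    have h2 := forall_const_mul (fun δ hδ => (h δ hδ).scale hs) (div_nonneg hc hs.le) htη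
    rw [mul_one] at h2
    exact h2.congr heq
  have hφt : IntegrableOn φ (Ioc 0 t) := hφ.integrableOn.mono_set Ioc_subset_Ioi_self
  -- The tail of `φ` has mass `1 - ∫ φ` over `(0, t]`, where `φ` is within `η` of 1.
  have hdiff : |(c / s) - (1 - t)| ≤ t * η := by
    have h2 := setIntegral_Ioc_add_shift hφ.integrableOn ht0.le
    rw [hmass, hφ.2.2] at h2
    have h3 : ‖∫ x in Ioc 0 t, (φ x - 1)‖ ≤ η * volume.real (Ioc 0 t) :=
      norm_setIntegral_le_of_norm_le_const (by simp) hclose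
    rw [integral_sub hφt (integrableOn_const (by simp)), setIntegral_const, hvol, smul_eq_mul,
      mul_one, Real.norm_eq_abs] at h3
    have : c / s - (1 - t) = -((∫ x in Ioc 0 t, φ x) - t) := by linarith
    rw [this, abs_neg, mul_comm]
    exact h3
  have h₂' := h₂.mass hU hdiff
  have key := of_shift S hDPP (integrableOn_uniformDensity 1)
    (fun t _ => uniformDensity_nonneg zero_le_one t)
    (by rw [setIntegral_uniformDensity one_pos]; exact one_pos) hφ.integrableOn hφ.2.1
    (by rw [hφ.2.2]; exact one_pos) ht0 h₁ h₂' (h (t * η) htη)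
  have hint : ∫ x in Ioc 0 t, |uniformDensity 1 x - φ x| ≤ t * η := by
    have h3 : ‖∫ x in Ioc 0 t, |uniformDensity 1 x - φ x|‖ ≤ η * volume.real (Ioc 0 t) :=
      norm_setIntegral_le_of_norm_le_const (by simp) fun x hx => by
        rw [uniformDensity_of_mem ⟨hx.1.le, hx.2.trans ht1.le⟩, Real.norm_eq_abs, abs_abs,
          abs_sub_comm, div_one]
        exact hclose x hx
    rw [hvol, mul_comm] at h3
    exact (le_abs_self _).trans h3
  -- The error in `key` is at most `(1 - t) * δ + 4 * t * η` with `δ < d + t * η`, which falls below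
  -- `d`.
  have hle := csInf_le hbdd (show _ ∈ D from key)
  rw [← hd] at hle
  have h5 : (1 - t) * δ ≤ (1 - t) * (d + t * η) :=
    mul_le_mul_of_nonneg_left hδ.le (sub_pos.2 ht1).le
  have h6 : t * (8 * η) ≤ t * d := mul_le_mul_of_nonneg_left (by rw [hη]; linarith) ht0.le
  have h7 : 0 < t * (t * η) := mul_pos ht0 htη
  nlinarith

/-- Values of a weight vanishing after time `n * τ` and oscillating by at most `η` in time `τ`. -/
lemma of_oscillation (S : IsPayoffSystem K g) (hDPP : DynamicProgramming K g)
    (hU : ∀ ω, U ω ∈ Icc (0 : ℝ) 1)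
    (hu : ∀ δ, 0 < δ → EventuallyNear K g U (uniformDensity 1) 1 δ) {τ η : ℝ} (hτ : 0 < τ)
    (hη : 0 < η) (n : ℕ) : ∀ f : ℝ → ℝ, IntegrableOn f (Ioi 0) → (∀ t, 0 ≤ t → 0 ≤ f t) →
      (∀ x, n * τ ≤ x → f x = 0) → (∀ x y, 0 ≤ x → 0 ≤ y → |x - y| ≤ τ → |f x - f y| ≤ η) →
      ∀ δ, 0 < δ → EventuallyNear K g U f (∫ t in Ioi 0, f t) (n * (4 * η * τ) + δ) := by
  induction n with
  | zero =>
    intro f _ _ hf0 _ δ hδ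
    have h0 : EqOn (fun _ => 0) f (Ioi 0) := fun x hx => by
      rw [hf0 x (by simpa using le_of_lt hx)]
    rw [← setIntegral_congr_fun measurableSet_Ioi h0, integral_zero]
    exact (zero (by simpa using hδ.le)).congr h0
  | succ n ih =>
    intro f hf hf0 hfn hosc δ hδ
    have hnn : 0 ≤ ∫ t in Ioi 0, f t :=
      setIntegral_nonneg measurableSet_Ioi fun t ht => hf0 t (le_of_lt ht)
    -- Dynamic programming needs positive mass; a weight of mass zero is at L¹ distance zero from 0.
    rcases hnn.eq_or_lt with hz | hpos
    · rw [← hz]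
      refine (approx S (σ := fun _ => 0) (zero hδ.le) hf integrableOn_zero (δ' := 0) ?_).mono ?_
      · refine le_of_le_of_eq (le_of_eq ?_) hz.symm
        refine (setIntegral_congr_fun measurableSet_Ioi fun t (ht : 0 < t) => ?_)
        rw [sub_zero, abs_of_nonneg (hf0 t ht.le)]
      · have : 0 ≤ ((n + 1 : ℕ) : ℝ) * (4 * η * τ) := by positivity
        linarith
    set R := ∫ t in Ioi 0, f (t + τ) with hR
    have hR0 : 0 ≤ R := setIntegral_nonneg measurableSet_Ioi fun t (ht : 0 < t) =>
      hf0 _ (by linarith)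
    -- Adding `η` keeps the height positive when `f 0 = 0`, and makes `f` deviate from `b` by up to
    -- `2 * η` on the first step.
    set b := f 0 + η with hb
    have hb0 : 0 < b := add_pos_of_nonneg_of_pos (hf0 0 le_rfl) hη
    -- With this length, the part of the block after `τ` has mass `R`, exactly that of the tail of
    -- `f`.
    set T := τ + R / b with hT
    have hτT : τ ≤ T := le_add_of_nonneg_right (div_nonneg hR0 hb0.le)
    have hT0 : 0 < T := hτ.trans_le hτT
    have hbT : b * T = b * τ + R := by rw [hT]; field_simp
    have hvol : volume.real (Ioc 0 τ) = τ := by rw [Real.volume_real_Ioc_of_le hτ.le, sub_zero]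
    have hosc0 : ∀ x ∈ Ioc 0 τ, |f x - b| ≤ 2 * η := fun x hx => by
      have h1 := hosc x 0 hx.1.le le_rfl (by rw [sub_zero, abs_of_pos hx.1]; exact hx.2)
      rw [hb, ← sub_sub]
      refine (abs_sub _ _).trans ?_
      rw [abs_of_pos hη]
      linarith
    have h₁ : EventuallyNear K g U (fun x => f (x + τ)) R (n * (4 * η * τ) + δ / 3) := by
      refine ih _ (integrableOn_shift hf hτ.le) (fun t ht => hf0 _ (by linarith))
        (fun x hx => hfn _ ?_) (fun x y hx hy hxy => hosc _ _ (by linarith) (by linarith) ?_)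
        (δ / 3) (by positivity)
      · push_cast
        linarith
      · rwa [add_sub_add_right_eq_sub]
    have h₂ : EventuallyNear K g U (fun x => b * T * uniformDensity T (x + τ)) R (δ / 3) := by
      have h2 := const_mul_uniformDensity hu (div_nonneg hR0 hb0.le) hb0.le
        (show 0 < δ / 3 by positivity)
      rw [mul_div_cancel₀ R hb0.ne'] at h2
      refine h2.congr fun x hx => ?_
      simp only
      rw [mul_assoc, uniformDensity_shift hτ hx, hT, add_sub_cancel_left, ← mul_assoc,
        mul_div_cancel₀ R hb0.ne']
    have h₃ := const_mul_uniformDensity hu hT0.le hb0.le (show 0 < δ / 3 by positivity)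
    have key := of_shift S hDPP hf hf0 hpos ((integrableOn_uniformDensity T).const_mul (b * T))
      (fun t _ => mul_nonneg (by positivity) (uniformDensity_nonneg hT0.le t))
      (by rw [integral_const_mul, setIntegral_uniformDensity hT0]; positivity) hτ h₁ h₂ h₃
    have hdiff : |b * T - ∫ t in Ioi 0, f t| ≤ 2 * η * τ := by
      have h3 : ‖∫ x in Ioc 0 τ, (f x - b)‖ ≤ 2 * η * volume.real (Ioc 0 τ) :=
        norm_setIntegral_le_of_norm_le_const (by simp) hosc0
      rw [integral_sub (hf.mono_set Ioc_subset_Ioi_self) (integrableOn_const (by simp)),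
        setIntegral_const, hvol, smul_eq_mul, Real.norm_eq_abs, abs_sub_comm] at h3
      rw [← setIntegral_Ioc_add_shift hf hτ.le, hbT, ← hR, add_sub_add_right_eq_sub, mul_comm b]
      exact h3
    have hint : ∫ x in Ioc 0 τ, |f x - b * T * uniformDensity T x| ≤ 2 * η * τ := by
      have h3 : ‖∫ x in Ioc 0 τ, |f x - b * T * uniformDensity T x|‖
          ≤ 2 * η * volume.real (Ioc 0 τ) :=
        norm_setIntegral_le_of_norm_le_const (by simp) fun x hx => by
          rw [uniformDensity_of_mem ⟨hx.1.le, hx.2.trans hτT⟩, Real.norm_eq_abs, abs_abs,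
            mul_assoc, mul_one_div_cancel hT0.ne', mul_one]
          exact hosc0 x hx
      rw [hvol] at h3
      exact (le_abs_self _).trans h3
    -- One step adds `2 * η * τ` for the L¹ distance on `(0, τ]` and as much for the difference of
    -- total masses.
    refine (key.mass hU hdiff).mono ?_
    push_cast
    linarith

/-- If the values of the uniform densities converge, so do the values of the rescalings of every
density. -/
theorem of_uniformDensity (S : IsPayoffSystem K g) (hDPP : DynamicProgramming K g)
    (hU : ∀ ω, U ω ∈ Icc (0 : ℝ) 1)
    (hu : ∀ δ, 0 < δ → EventuallyNear K g U (uniformDensity 1) 1 δ) {ρ : ℝ → ℝ}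
    (hρ : IsDensity ρ) {δ : ℝ} (hδ : 0 < δ) : EventuallyNear K g U ρ 1 δ := by
  have hind : Integrable ((Ioi 0).indicator ρ) :=
    (integrable_indicator_iff measurableSet_Ioi).2 hρ.integrableOn
  obtain ⟨f, hfs, hfd, hfc, hfi⟩ :=
    hind.exists_hasCompactSupport_integral_sub_le (show 0 < δ / 4 by positivity)
  -- The positive part restores non-negativity without moving away from `ρ ≥ 0` or increasing
  -- oscillation.
  have hpi : IntegrableOn (fun t => max (f t) 0) (Ioi 0) := hfi.pos_part.integrableOn
  have hd : ∫ t in Ioi 0, |ρ t - max (f t) 0| ≤ δ / 4 := by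
    refine le_trans ?_ hfd
    have h1 : Integrable fun x => ‖(Ioi 0).indicator ρ x - f x‖ := (hind.sub hfi).norm
    refine le_trans ?_ (setIntegral_le_integral (s := Ioi 0) h1
      (Eventually.of_forall fun x => norm_nonneg _))
    refine setIntegral_mono_on (hρ.integrableOn.sub hpi).abs h1.integrableOn measurableSet_Ioi
      fun x hx => ?_
    rw [indicator_of_mem hx, Real.norm_eq_abs]
    have h2 := abs_max_sub_max_le_abs (ρ x) (f x) 0
    rwa [max_eq_left (hρ.2.1 x (le_of_lt hx))] at h2
  obtain ⟨A, hA0, hA⟩ : ∃ A : ℝ, 0 < A ∧ ∀ x, A ≤ x → f x = 0 := by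
    obtain ⟨B, hB⟩ := hfs.isCompact.isBounded.bddAbove
    refine ⟨max B 0 + 1, by positivity, fun x hx => image_eq_zero_of_notMem_tsupport fun hmem => ?_⟩
    linarith [hB hmem, le_max_left B 0]
  -- The `n` steps of length `A / n` cost `4 * η * A = δ / 4` in all; the L¹ error, the mass error
  -- and the slack take the other quarters.
  set η := δ / (16 * A) with hη
  have hη0 : 0 < η := by positivity
  obtain ⟨r, hr0, hr⟩ := Metric.uniformContinuous_iff.1
    (hfs.uniformContinuous_of_continuous hfc) η hη0
  obtain ⟨n, hn⟩ := exists_nat_gt (A / r)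
  have hn0 : (0 : ℝ) < n := (div_pos hA0 hr0).trans hn
  have hτr : A / n < r := by
    rw [div_lt_iff₀ hn0, mul_comm]
    exact (div_lt_iff₀ hr0).1 hn
  have hnτ : n * (A / n) = A := mul_div_cancel₀ A hn0.ne'
  have hnear := of_oscillation S hDPP hU hu (div_pos hA0 hn0) hη0 n (fun t => max (f t) 0) hpi
    (fun t _ => le_max_right _ _) (fun x hx => by
      rw [hnτ] at hx
      rw [hA x hx, max_self])
    (fun x y _ _ hxy => (abs_max_sub_max_le_abs _ _ _).trans
      (hr (show dist x y < r from hxy.trans_lt hτr)).le) (δ / 4) (by positivity)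
  have hm : |(∫ t in Ioi 0, max (f t) 0) - 1| ≤ δ / 4 := by
    rw [← hρ.2.2, ← integral_sub hpi hρ.integrableOn]
    refine abs_integral_le_integral_abs.trans (le_trans (le_of_eq ?_) hd)
    simp only [abs_sub_comm]
  refine (approx S (hnear.mass hU hm) hρ.integrableOn hpi hd).mono ?_
  have : n * (4 * η * (A / n)) = δ / 4 := by
    rw [hη]
    field_simp
    norm_num
  linarith

end EventuallyNear

/-! ### Changes of parameter -/

lemma tendstoUniformly_reindex {ι κ : Type*} {F : ι → Ω → ℝ} {G : κ → Ω → ℝ} {U : Ω → ℝ}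
    {p : Filter ι} {q : Filter κ} (h : TendstoUniformly F U p) {r : κ → ι} (hr : Tendsto r q p)
    (hFG : ∀ᶠ k in q, ∀ ω, F (r k) ω = G k ω) : TendstoUniformly G U q := by
  intro u hu
  filter_upwards [hr.eventually (h u hu), hFG] with k hk hk' ω
  rw [← hk' ω]
  exact hk ω

lemma tendstoUniformly_uniformDensity_iff {U : Ω → ℝ} :
    TendstoUniformly (fun T => value K g (uniformDensity T)) U atTop ↔
      TendstoUniformly (fun a => value K g (scale (uniformDensity 1) a)) U (𝓝[>] 0) := by
  constructor
  · intro h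
    refine tendstoUniformly_reindex h tendsto_inv_nhdsGT_zero ?_
    filter_upwards [self_mem_nhdsWithin] with a (ha : 0 < a) ω
    exact value_congr (fun t ht => (scale_uniformDensity_one ha ht).symm) ω
  · intro h
    refine tendstoUniformly_reindex h tendsto_inv_atTop_nhdsGT_zero ?_
    filter_upwards [eventually_gt_atTop 0] with T hT ω
    refine value_congr (fun t ht => ?_) ω
    rw [scale_uniformDensity_one (inv_pos.2 hT) ht, inv_inv]

lemma scale_expDensity_one (a : ℝ) : scale (expDensity 1) a = expDensity a := by
  funext t
  simp only [scale, expDensity]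
  ring_nf

lemma isDensity_scale {ρ : ℝ → ℝ} (hρ : IsDensity ρ) {a : ℝ} (ha : 0 < a) :
    IsDensity (scale ρ a) :=
  ⟨(integrableOn_scale hρ.integrableOn ha).aestronglyMeasurable.aemeasurable,
    fun t ht => mul_nonneg ha.le (hρ.2.1 _ (mul_nonneg ha.le ht)), by
      rw [setIntegral_scale ρ ha, hρ.2.2]⟩

lemma isDensity_expDensity_one : IsDensity (expDensity 1) := by
  have h : expDensity 1 = fun t => Real.exp (-t) := by
    funext t
    simp [expDensity]
  rw [h]
  exact ⟨(by fun_prop : Measurable fun t : ℝ => Real.exp (-t)).aemeasurable,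
    fun t _ => (Real.exp_pos _).le, integral_exp_neg_Ioi_zero⟩

lemma piecewiseContinuousOnPos_uniformDensity_one :
    PiecewiseContinuousOnPos (uniformDensity 1) := by
  have hleft : ∀ t : ℝ, 0 < t → t ≤ 1 → ∀ᶠ x in 𝓝[<] t, uniformDensity 1 x = 1 := by
    intro t h0 h1
    filter_upwards [Ioo_mem_nhdsLT h0] with x hx
    rw [uniformDensity_of_mem ⟨hx.1.le, hx.2.le.trans h1⟩, div_one]
  have hlt : ∀ t : ℝ, 0 < t → t < 1 → ∀ᶠ x in 𝓝 t, uniformDensity 1 x = 1 := by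
    intro t h0 h1
    filter_upwards [Ioo_mem_nhds h0 h1] with x hx
    rw [uniformDensity_of_mem ⟨hx.1.le, hx.2.le⟩, div_one]
  have hgt : ∀ t : ℝ, 1 < t → ∀ᶠ x in 𝓝 t, uniformDensity 1 x = 0 := by
    intro t h1
    filter_upwards [Ioi_mem_nhds h1] with x hx using uniformDensity_of_lt hx
  refine ⟨fun a b ha _ => (finite_singleton (1 : ℝ)).subset ?_, fun t ht => ⟨?_, ?_⟩⟩
  · rintro t ⟨ht, hc⟩
    by_contra hne
    rcases lt_or_gt_of_ne (show t ≠ 1 from hne) with h | h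
    · exact hc (continuousAt_const.congr (EventuallyEq.symm (hlt t (ha.trans_le ht.1) h)))
    · exact hc (continuousAt_const.congr (EventuallyEq.symm (hgt t h)))
  · rcases le_or_gt t 1 with h | h
    · exact ⟨1, tendsto_const_nhds.congr' (EventuallyEq.symm (hleft t ht h))⟩
    · exact ⟨0, tendsto_const_nhds.congr'
        (EventuallyEq.symm ((hgt t h).filter_mono nhdsWithin_le_nhds))⟩
  · rcases lt_or_ge t 1 with h | h
    · exact ⟨1, tendsto_const_nhds.congr'
        (EventuallyEq.symm ((hlt t ht h).filter_mono nhdsWithin_le_nhds))⟩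
    · refine ⟨0, tendsto_const_nhds.congr' (EventuallyEq.symm ?_)⟩
      filter_upwards [self_mem_nhdsWithin] with x (hx : t < x)
      exact uniformDensity_of_lt (h.trans_lt hx)

/-! ### Power densities -/

lemma power_shift {α β γ x t : ℝ} (hα : 0 < α) (hβ : 0 < β) (hx : 0 ≤ x) (ht : 0 ≤ t) :
    1 / (α + β * (x + t)) ^ γ =
      (α / (α + β * t)) ^ γ * (1 / (α + β * (α / (α + β * t) * x)) ^ γ) := by
  have h1 : 0 < α + β * t := by positivity
  have h2 : α + β * (α / (α + β * t) * x) = α / (α + β * t) * (α + β * (x + t)) := by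
    field_simp
    ring
  have h3 : (0 : ℝ) < (α / (α + β * t)) ^ γ := by positivity
  rw [h2, Real.mul_rpow (by positivity) (by positivity), mul_one_div, div_mul_cancel_left₀ h3.ne',
    one_div]

/-- By `power_shift` the tail is a multiple of a rescaling of `ρ`; normalizing the mass to one
removes the multiple. -/
lemma IsPowerDensity.exists_shift_eq {ρ : ℝ → ℝ} (h : IsPowerDensity ρ) :
    ∃ α β : ℝ, 0 < α ∧ 0 < β ∧
      ∀ T, 0 ≤ T → EqOn (shift ρ T) (scale ρ (α / (α + β * T))) (Ioi 0) := by
  obtain ⟨hd, α, β, γ, hα, hβ, hγ, hρ⟩ := h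
  refine ⟨α, β, hα, hβ, fun T hT x (hx : 0 < x) => ?_⟩
  have hs : 0 < α / (α + β * T) := by positivity
  have hshift : ∀ y, 0 < y →
      ρ (y + T) = (α / (α + β * T)) ^ γ * ρ (α / (α + β * T) * y) := fun y hy => by
    rw [hρ _ (by positivity), hρ _ (by positivity), power_shift hα hβ hy.le hT]
  set s := α / (α + β * T)
  have hsγ : 0 < s ^ γ := by positivity
  have hint : ∫ y in Ioi T, ρ y = s ^ γ / s := by
    have h2 : EqOn (fun y => ρ (y + T)) (fun y => s ^ γ / s * scale ρ s y) (Ioi 0) := by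
      intro y hy
      simp only [scale]
      rw [hshift y hy]
      field_simp
    rw [← setIntegral_Ioi_shift, setIntegral_congr_fun measurableSet_Ioi h2, integral_const_mul,
      setIntegral_scale ρ hs, hd.2.2, mul_one]
  simp only [shift, scale]
  rw [hint, hshift x hx]
  field_simp

lemma IsPowerDensity.tendstoUniformly_shift_iff {ρ : ℝ → ℝ} (h : IsPowerDensity ρ) {U : Ω → ℝ} :
    TendstoUniformly (fun T => value K g (shift ρ T)) U atTop ↔
      TendstoUniformly (fun a => value K g (scale ρ a)) U (𝓝[>] 0) := by
  obtain ⟨α, β, hα, hβ, hs⟩ := h.exists_shift_eq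
  constructor
  · intro h
    -- This is the inverse of the substitution `a = α / (α + β * T)`.
    have ht : Tendsto (fun a => (α * a⁻¹ - α) / β) (𝓝[>] 0) atTop :=
      (tendsto_atTop_add_const_right _ (-α)
        (tendsto_inv_nhdsGT_zero.const_mul_atTop hα)).atTop_div_const hβ
    refine tendstoUniformly_reindex h ht ?_
    filter_upwards [ht.eventually (eventually_ge_atTop 0), self_mem_nhdsWithin]
      with a hT (ha : 0 < a) ω
    rw [value_congr (hs _ hT) ω]
    congr 2
    field_simp
    ring
  · intro h
    have h1 : Tendsto (fun T => α + β * T) atTop atTop :=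
      tendsto_atTop_add_const_left _ α (tendsto_id.const_mul_atTop hβ)
    have ht : Tendsto (fun T => α / (α + β * T)) atTop (𝓝[>] 0) := by
      refine tendsto_nhdsWithin_iff.2 ⟨h1.const_div_atTop α, ?_⟩
      filter_upwards [h1.eventually (eventually_gt_atTop 0)] with T hT using div_pos hα hT
    refine tendstoUniformly_reindex h ht ?_
    filter_upwards [eventually_ge_atTop 0] with T hT ω
    exact (value_congr (hs T hT) ω).symm

lemma IsPowerDensity.uniformDensity_of_scale (S : IsPayoffSystem K g)
    (hDPP : DynamicProgramming K g) {ρ : ℝ → ℝ} (h : IsPowerDensity ρ) {U : Ω → ℝ}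
    (hU : ∀ ω, U ω ∈ Icc (0 : ℝ) 1) (hlim : ∀ δ, 0 < δ → EventuallyNear K g U ρ 1 δ) :
    ∀ δ, 0 < δ → EventuallyNear K g U (uniformDensity 1) 1 δ := by
  obtain ⟨hd, α, β, γ, hα, hβ, hγ, hρ⟩ := h
  have hr : 0 < α ^ γ := by positivity
  -- Rescaling by `α ^ γ = 1 / ρ 0` makes the density equal to 1 at 0.
  refine EventuallyNear.uniformDensity_of_selfSimilar S hDPP (isDensity_scale hd hr) ?_ ?_ hU
    fun δ hδ => (hlim δ hδ).scale hr
  · have hc : ContinuousAt (fun t => α ^ γ * (1 / (α + β * (α ^ γ * t)) ^ γ)) 0 := by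
      have h0 : α + β * (α ^ γ * 0) ≠ 0 := by simpa using hα.ne'
      have h1 : (α + β * (α ^ γ * 0)) ^ γ ≠ 0 := by simpa using hr.ne'
      refine continuousAt_const.mul (continuousAt_const.div ?_ h1)
      exact ContinuousAt.rpow_const (by fun_prop) (Or.inl h0)
    have hc' := hc.tendsto.mono_left (nhdsWithin_le_nhds (s := Ioi 0))
    simp only [mul_zero, add_zero, mul_one_div_cancel hr.ne'] at hc'
    refine hc'.congr' ?_
    filter_upwards [self_mem_nhdsWithin] with t (ht : 0 < t)
    simp only [scale]
    rw [hρ _ (by positivity)]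
  · intro t ht
    refine ⟨(α / (α + β * (α ^ γ * t))) ^ γ, α / (α + β * (α ^ γ * t)), by positivity,
      by positivity, fun x hx => ?_⟩
    simp only [scale]
    rw [hρ _ (by positivity), hρ _ (by positivity), mul_add,
      power_shift hα hβ (by positivity) (by positivity)]
    ring_nf

lemma exists_isPowerDensity : ∃ ρ, IsPowerDensity ρ := by
  have h0 : EqOn (fun t : ℝ => 1 / (1 + 1 * t) ^ (2 : ℝ)) (fun t => (t + 1) ^ (-2 : ℝ))
      (Ioi 0) := fun t (ht : 0 < t) => by
    simp only
    rw [Real.rpow_neg (by positivity), one_div, one_mul, add_comm]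
  refine ⟨fun t => 1 / (1 + 1 * t) ^ (2 : ℝ), ⟨?_, fun t ht => by positivity, ?_⟩, 1, 1, 2,
    one_pos, one_pos, two_pos, fun _ _ => rfl⟩
  · exact (by fun_prop : Measurable fun t : ℝ => 1 / (1 + 1 * t) ^ (2 : ℝ)).aemeasurable
  · rw [setIntegral_congr_fun measurableSet_Ioi h0,
      setIntegral_Ioi_shift (fun t => t ^ (-2 : ℝ)) 1, integral_Ioi_rpow_of_lt (by norm_num) one_pos]
    norm_num

/-! ### The Tauberian theorem -/

/-- The exponential law is memoryless: its tail is `exp (-t)` times itself, so self-similarity holds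
with `s = 1`. -/
lemma expDensity_uniformDensity (S : IsPayoffSystem K g) (hDPP : DynamicProgramming K g)
    {U : Ω → ℝ} (hU : ∀ ω, U ω ∈ Icc (0 : ℝ) 1)
    (hlim : ∀ δ, 0 < δ → EventuallyNear K g U (expDensity 1) 1 δ) :
    ∀ δ, 0 < δ → EventuallyNear K g U (uniformDensity 1) 1 δ := by
  refine EventuallyNear.uniformDensity_of_selfSimilar S hDPP isDensity_expDensity_one ?_ ?_ hU hlim
  · have hc : Continuous (expDensity 1) := by
      unfold expDensity
      fun_prop
    have := (hc.tendsto 0).mono_left (nhdsWithin_le_nhds (s := Ioi 0))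
    simpa [expDensity] using this
  · refine fun t _ => ⟨Real.exp (-t), 1, (Real.exp_pos _).le, one_pos, fun x _ => ?_⟩
    simp only [expDensity]
    rw [one_mul, one_mul, one_mul, ← Real.exp_add]
    ring_nf

theorem tendstoUniformly_scale_of_uniformDensity (S : IsPayoffSystem K g)
    (hDPP : DynamicProgramming K g) {U : Ω → ℝ}
    (h : TendstoUniformly (fun T => value K g (uniformDensity T)) U atTop) {ρ : ℝ → ℝ}
    (hρ : IsDensity ρ) : TendstoUniformly (fun a => value K g (scale ρ a)) U (𝓝[>] 0) := by
  rw [tendstoUniformly_uniformDensity_iff] at h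
  exact tendstoUniformly_scale_iff.2 fun δ hδ => EventuallyNear.of_uniformDensity S hDPP
    (mem_Icc_of_tendstoUniformly S (isDensity_uniformDensity one_pos) h)
    (tendstoUniformly_scale_iff.1 h) hρ hδ

theorem tendstoUniformly_tfae (S : IsPayoffSystem K g) (hDPP : DynamicProgramming K g)
    (U : Ω → ℝ) : List.TFAE [
        ∀ μ, IsPiecewiseContinuousDensity μ →
          TendstoUniformly (fun a => value K g (scale μ a)) U (𝓝[>] 0),
        TendstoUniformly (fun T => value K g (uniformDensity T)) U atTop,
        TendstoUniformly (fun a => value K g (expDensity a)) U (𝓝[>] 0),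
        ∃ ρ, IsPowerDensity ρ ∧
          TendstoUniformly (fun T => value K g (shift ρ T)) U atTop,
        ∀ ρ, IsPowerDensity ρ →
          TendstoUniformly (fun T => value K g (shift ρ T)) U atTop] := by
  tfae_have 1 → 2 := fun h => tendstoUniformly_uniformDensity_iff.2
    (h _ ⟨isDensity_uniformDensity one_pos, piecewiseContinuousOnPos_uniformDensity_one⟩)
  tfae_have 2 → 1 := fun h μ hμ => tendstoUniformly_scale_of_uniformDensity S hDPP h hμ.1
  tfae_have 2 → 3 := fun h => by
    have h1 := tendstoUniformly_scale_of_uniformDensity S hDPP h isDensity_expDensity_one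
    simpa only [scale_expDensity_one] using h1
  tfae_have 3 → 2 := fun h => by
    have h1 : TendstoUniformly (fun a => value K g (scale (expDensity 1) a)) U (𝓝[>] 0) := by
      simpa only [scale_expDensity_one] using h
    exact tendstoUniformly_uniformDensity_iff.2 (tendstoUniformly_scale_iff.2
      (expDensity_uniformDensity S hDPP
        (mem_Icc_of_tendstoUniformly S isDensity_expDensity_one h1)
        (tendstoUniformly_scale_iff.1 h1)))
  tfae_have 2 → 5 := fun h ρ hρ =>
    hρ.tendstoUniformly_shift_iff.2 (tendstoUniformly_scale_of_uniformDensity S hDPP h hρ.1)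
  tfae_have 5 → 4 := fun h => by
    obtain ⟨ρ, hρ⟩ := exists_isPowerDensity
    exact ⟨ρ, hρ, h ρ hρ⟩
  tfae_have 4 → 2 := by
    rintro ⟨ρ, hρ, h⟩
    rw [hρ.tendstoUniformly_shift_iff] at h
    exact tendstoUniformly_uniformDensity_iff.2 (tendstoUniformly_scale_iff.2
      (hρ.uniformDensity_of_scale S hDPP (mem_Icc_of_tendstoUniformly S hρ.1 h)
        (tendstoUniformly_scale_iff.1 h)))
  tfae_finish

end ControlTauber

theorem mainTheorem5 {Ω : Type*} [Nonempty Ω] (K : Set (ℝ≥0 → Ω)) (g : Ω → ℝ)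
    (hg : ∀ ω, g ω ∈ Icc (0 : ℝ) 1)
    (hmeas : ∀ z ∈ K,
      AEMeasurable (fun t : ℝ => g (z t.toNNReal)) (volume.restrict (Ioi 0)))
    (hstart : ∀ ω, ∃ z ∈ K, z 0 = ω)
    (hDPP : DynamicProgramming K g) :
    (∀ U : Ω → ℝ,
      List.TFAE [
        ∀ μ, IsPiecewiseContinuousDensity μ →
          TendstoUniformly (fun a => value K g (scale μ a)) U (𝓝[>] 0),
        TendstoUniformly (fun T => value K g (uniformDensity T)) U atTop,
        TendstoUniformly (fun a => value K g (expDensity a)) U (𝓝[>] 0),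
        ∃ ρ, IsPowerDensity ρ ∧
          TendstoUniformly (fun T => value K g (shift ρ T)) U atTop,
        ∀ ρ, IsPowerDensity ρ →
          TendstoUniformly (fun T => value K g (shift ρ T)) U atTop]) ∧
    ((∃ U, TendstoUniformly (fun T => value K g (uniformDensity T)) U atTop) ∨
      (∃ U, TendstoUniformly (fun a => value K g (expDensity a)) U (𝓝[>] 0)) ∨
      (∃ ρ, IsPowerDensity ρ ∧
        ∃ U, TendstoUniformly (fun T => value K g (shift ρ T)) U atTop) →
      ∃ U : Ω → ℝ,
        TendstoUniformly (fun T => value K g (uniformDensity T)) U atTop ∧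
        TendstoUniformly (fun a => value K g (expDensity a)) U (𝓝[>] 0) ∧
        (∀ ρ, IsPowerDensity ρ →
          TendstoUniformly (fun T => value K g (shift ρ T)) U atTop) ∧
        (∀ μ, IsPiecewiseContinuousDensity μ →
          TendstoUniformly (fun a => value K g (scale μ a)) U (𝓝[>] 0))) := by
  have S : IsPayoffSystem K g := ⟨hg, hmeas, hstart⟩
  refine ⟨tendstoUniformly_tfae S hDPP, fun h => ?_⟩
  obtain ⟨U, hU⟩ : ∃ U, TendstoUniformly (fun T => value K g (uniformDensity T)) U atTop := by
    rcases h with h | ⟨U, h⟩ | ⟨ρ, hρ, U, h⟩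
    · exact h
    · exact ⟨U, ((tendstoUniformly_tfae S hDPP U).out 2 1).1 h⟩
    · have hU := ((tendstoUniformly_tfae S hDPP U).out 3 1).1
      exact ⟨U, hU ⟨ρ, hρ, h⟩⟩
  exact ⟨U, hU, ((tendstoUniformly_tfae S hDPP U).out 1 2).1 hU,
    ((tendstoUniformly_tfae S hDPP U).out 1 4).1 hU,
    ((tendstoUniformly_tfae S hDPP U).out 1 0).1 hU⟩
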